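/- Let $p_Z$ be a probability density function on $\mathbb{R}$ such that, for some $\zeta\in(0,1)$, $$\int_{\mathbb{R}} p_Z(z)\,(\ln p_Z(z))^4\,dz<\infty,\qquad \int_{\mathbb{R}} p_Z(z)^{\zeta}\,dz<\infty,\qquad \int_{\mathbb{R}} p_Z(z)^{\zeta}\,(\ln p_Z(z))^4\,dz<\infty$$ (the integrands are taken to be $0$ where $p_Z(z)=0$). Consider the memoryless additive-noise channel $Y_i=X_i+Z_i$, $i=1,\dots,n$, where $Z_1,\dots,Z_n$ are i.i.d. with density $p_Z$ and independent of the input. A code of length $n$ with finite nonempty message set $\mathcal{M}$ and finite nonempty key set $\mathcal{K}$ consists of an encoder $f:\mathcal{M}\times\mathcal{K}\to\mathbb{R}^n$ and a measurable decoder $g:\mathbb{R}^n\times\mathcal{K}\to\mathcal{M}$. The message and the key are uniformly distributed and independent of each other and of the noise; $X^n=f(m,k)$ is sent when the message is $m$ and the key is $k$, and $P_{Y^n}$ denotes the law of the output $Y^n=X^n+Z^n$ averaged over message and key. Fix $\Delta>0$. For $\epsilon>0$ let $A_n(\Delta,\epsilon)$ be the maximum (supremum) of $\ln|\mathcal{M}|$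 over all codes of length $n$, with key sets of any finite size, such that $D(P_{Y^n}\|P_{Z^n})\le\Delta$ (Kullback–Leibler divergence in nats) and such that the probability of decoding error, averaged over message and key, is at most $\epsilon$. Define $$L=\lim_{\epsilon\downarrow 0}\ \liminf_{n\to\infty}\ \frac{A_n(\Delta,\epsilon)}{\sqrt{n\Delta}} .$$ Then the limit defining $L$ exists in $[-\infty,\infty]$, and $$L\le\sqrt{2}\,\sqrt{\operatorname{Var}[\ln p_Z(Z)]},$$ where $Z$ has density $p_Z$. Moreover, if $p_Z$ is (almost everywhere) the uniform density on a measurable set $\mathcal{S}\subseteq\mathbb{R}$, that is, $1/\lambda(\mathcal{S})$ on $\mathcal{S}$ and $0$ elsewhere, with $\lambda$ Lebesgue measure, then $L=0$. -/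

import Mathlib

open MeasureTheory ProbabilityTheory InformationTheory Filter
open scoped Topology ENNReal

noncomputable section

namespace CovertComm

/-- `p` is a probability density function on `ℝ` with respect to Lebesgue measure. -/
structure IsPDF (p : ℝ → ℝ) : Prop where
  aemeasurable : AEMeasurable p volume
  nonneg : ∀ z, 0 ≤ p z
  lintegral_eq_one : ∫⁻ z, ENNReal.ofReal (p z) = 1

/-- The law `P_Z` of a single noise variable with density `p`. -/
def noise (p : ℝ → ℝ) : Measure ℝ :=
  volume.withDensity fun z => ENNReal.ofReal (p z)

/-- The law `P_{Z^n}` of the i.i.d. noise vector of length `n`. -/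
def noiseVec (p : ℝ → ℝ) (n : ℕ) : Measure (Fin n → ℝ) :=
  Measure.pi fun _ => noise p

/-- The conditional law of the output `Y^n = x^n + Z^n` given the input `X^n = x^n`. -/
def channelLaw (p : ℝ → ℝ) {n : ℕ} (x : Fin n → ℝ) : Measure (Fin n → ℝ) :=
  (noiseVec p n).map fun z => x + z

/-- A deterministic code of length `n` with `M` messages and `K` keys; the key is shared by
the encoder and the decoder. -/
structure Code (n M K : ℕ) where
  enc : Fin M → Fin K → Fin n → ℝ
  dec : (Fin n → ℝ) → Fin K → Fin M
  measurable_dec : ∀ k, Measurable fun y => dec y k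

/-- The law `P_{Y^n}` of the output, averaged over a uniform message and an independent
uniform key. -/
def Code.outputLaw {n M K : ℕ} (c : Code n M K) (p : ℝ → ℝ) : Measure (Fin n → ℝ) :=
  ((K : ℝ≥0∞) * (M : ℝ≥0∞))⁻¹ • ∑ m : Fin M, ∑ k : Fin K, channelLaw p (c.enc m k)

/-- The probability of decoding error, averaged over a uniform message and an independent
uniform key. -/
def Code.avgError {n M K : ℕ} (c : Code n M K) (p : ℝ → ℝ) : ℝ≥0∞ :=
  ((K : ℝ≥0∞) * (M : ℝ≥0∞))⁻¹ *
    ∑ m : Fin M, ∑ k : Fin K, channelLaw p (c.enc m k) {y | c.dec y k ≠ m}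

/-- Covertness: `D(P_{Y^n} ‖ P_{Z^n}) ≤ Δ`, in nats. -/
def Code.IsCovert {n M K : ℕ} (c : Code n M K) (p : ℝ → ℝ) (Δ : ℝ) : Prop :=
  klDiv (c.outputLaw p) (noiseVec p n) ≤ ENNReal.ofReal Δ

/-- `A_n(Δ, ε)`: the largest `ln M` over all codes of length `n` (with any finite nonempty
message and key sets) that are `Δ`-covert and have average error probability at most `ε`. -/
def maxLogMessages (p : ℝ → ℝ) (Δ ε : ℝ) (n : ℕ) : EReal :=
  sSup {a : EReal | ∃ M K : ℕ, 0 < M ∧ 0 < K ∧ a = ((Real.log M : ℝ) : EReal) ∧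
    ∃ c : Code n M K, c.IsCovert p Δ ∧ c.avgError p ≤ ENNReal.ofReal ε}

/-- `liminf_{n → ∞} A_n(Δ, ε) / √(nΔ)`. -/
def scalingAt (p : ℝ → ℝ) (Δ ε : ℝ) : EReal :=
  liminf (fun n : ℕ => maxLogMessages p Δ ε n / ((Real.sqrt (n * Δ) : ℝ) : EReal)) atTop

/-- The square-root scaling constant `L = lim_{ε ↓ 0} liminf_{n → ∞} A_n(Δ, ε) / √(nΔ)`. -/
def scalingConstant (p : ℝ → ℝ) (Δ : ℝ) : EReal :=
  limUnder (𝓝[>] (0 : ℝ)) fun ε => scalingAt p Δ ε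

end CovertComm

end

/-!
Let `g = -log p - h(Z)` be the centred information density of the noise and `Gₙ` its sum over
`n` coordinates. Translations preserve differential entropy, so `D(x + Zⁿ ‖ Zⁿ)` is the mean of
`Gₙ` under the output law of the codeword `x`. Fano's inequality with `P_{Zⁿ}` as reference
measure, for each key and then averaged over keys, bounds `(1 - ε) log M` by `1 + E[Gₙ(Yⁿ)]`.
Donsker–Varadhan and covertness bound `t E[Gₙ(Yⁿ)]` by `Δ + n log E[exp(t g(Z))]`, and
`log E[exp(t g(Z))] ≈ t² Var[g(Z)] / 2`. With `t = s √(Δ / n)` this gives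
`L ≤ 1 / s + s Var[g(Z)] / 2`, which is least at `s = √2 / √Var[g(Z)]`. A uniform density has
`Var[g(Z)] = 0`.
-/

namespace CovertComm

section KullbackLeibler

variable {α : Type*} [MeasurableSpace α] {μ μ' ν : Measure α}

-- Donsker–Varadhan: the relative entropy of `μ` with respect to `ν.tilted f` is nonnegative.
lemma integral_le_toReal_klDiv_add_log_integral_exp [IsProbabilityMeasure μ]
    [IsProbabilityMeasure ν] (h : klDiv μ ν ≠ ∞) {f : α → ℝ} (hfμ : Integrable f μ)
    (hfν : Integrable (fun a => Real.exp (f a)) ν) :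
    ∫ a, f a ∂μ ≤ (klDiv μ ν).toReal + Real.log (∫ a, Real.exp (f a) ∂ν) := by
  obtain ⟨hac, hllr⟩ := klDiv_ne_top_iff.1 h
  have := isProbabilityMeasure_tilted hfν
  have hac' : μ ≪ ν.tilted f := hac.trans (absolutelyContinuous_tilted hfν)
  have hnonneg : 0 ≤ ∫ a, llr μ (ν.tilted f) a ∂μ := by
    rw [← toReal_klDiv_of_measure_eq hac' (by simp)]
    exact ENNReal.toReal_nonneg
  rw [integral_llr_tilted_right hac hfμ hfν hllr] at hnonneg
  rw [toReal_klDiv_of_measure_eq hac (by simp)]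
  linarith

lemma measureReal_mul_le_toReal_klDiv_add [IsProbabilityMeasure μ] [IsProbabilityMeasure ν]
    (h : klDiv μ ν ≠ ∞) {s : Set α} (hs : MeasurableSet s) (a : ℝ) :
    μ.real s * a ≤ (klDiv μ ν).toReal + ν.real s * (Real.exp a - 1) := by
  have hexp : (fun x => Real.exp (s.indicator (fun _ => a) x)) =
      fun x => 1 + s.indicator (fun _ => Real.exp a - 1) x := by
    ext x
    by_cases hx : x ∈ s <;> simp [hx]
  have hint : Integrable (s.indicator fun _ => Real.exp a - 1) ν :=
    (integrable_const _).indicator hs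
  have hmgf : ∫ x, Real.exp (s.indicator (fun _ => a) x) ∂ν = 1 + ν.real s * (Real.exp a - 1) := by
    rw [hexp, integral_add (integrable_const 1) hint, integral_indicator hs]
    simp
  have hpos : 0 < ∫ x, Real.exp (s.indicator (fun _ => a) x) ∂ν :=
    integral_exp_pos (by rw [hexp]; exact (integrable_const 1).add hint)
  calc μ.real s * a
      = ∫ x, s.indicator (fun _ => a) x ∂μ := by rw [integral_indicator hs]; simp
    _ ≤ (klDiv μ ν).toReal + Real.log (∫ x, Real.exp (s.indicator (fun _ => a) x) ∂ν) :=
        integral_le_toReal_klDiv_add_log_integral_exp h ((integrable_const a).indicator hs)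
          (by rw [hexp]; exact (integrable_const 1).add hint)
    _ ≤ _ := by linarith [Real.log_le_sub_one_of_pos hpos]

-- Fano's inequality: test `P i` against `ν` on `{d = i}` with exponent `log (card ι)`; the sets
-- are disjoint, so the error terms sum to at most `card ι`.
lemma sum_measureReal_mul_log_card_le {ι : Type*} [Fintype ι] [MeasurableSpace ι]
    [MeasurableSingletonClass ι] {P : ι → Measure α} [∀ i, IsProbabilityMeasure (P i)]
    [IsProbabilityMeasure ν] (h : ∀ i, klDiv (P i) ν ≠ ∞) {d : α → ι} (hd : Measurable d) :
    (∑ i, (P i).real {a | d a = i}) * Real.log (Fintype.card ι) ≤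
      ∑ i, (klDiv (P i) ν).toReal + Fintype.card ι := by
  have hpart : ∑ i, ν.real {a | d a = i} = 1 := by
    have := sum_measureReal_preimage_singleton (μ := ν) (f := d) Finset.univ
      fun i _ => hd (measurableSet_singleton i)
    simpa [Set.preimage, measureReal_def] using this
  obtain hι | hι := isEmpty_or_nonempty ι
  · simp
  have hcard : (0 : ℝ) < Fintype.card ι := by exact_mod_cast Fintype.card_pos
  calc (∑ i, (P i).real {a | d a = i}) * Real.log (Fintype.card ι)
      ≤ ∑ i, ((klDiv (P i) ν).toReal + ν.real {a | d a = i} * (Fintype.card ι - 1)) := by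
        rw [Finset.sum_mul]
        refine Finset.sum_le_sum fun i _ => ?_
        have := measureReal_mul_le_toReal_klDiv_add (h i) (hd (measurableSet_singleton i))
          (Real.log (Fintype.card ι))
        rwa [Real.exp_log hcard] at this
    _ = ∑ i, (klDiv (P i) ν).toReal + (Fintype.card ι - 1) := by
        rw [Finset.sum_add_distrib, ← Finset.sum_mul, hpart, one_mul]
    _ ≤ _ := by linarith

lemma abs_mul_log_le_one_add_abs_mul_log {x y : ℝ} (hx : 0 ≤ x) (hxy : x ≤ y) :
    |x * Real.log x| ≤ 1 + |y * Real.log y| := by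
  rcases le_total x 1 with h | h
  · obtain rfl | hx' := hx.eq_or_lt
    · simp only [zero_mul, abs_zero]
      positivity
    · have := Real.abs_log_mul_self_lt x hx' h
      rw [mul_comm]
      linarith [abs_nonneg (y * Real.log y)]
  · have hlog := Real.log_nonneg h
    have hy := hx.trans hxy
    have : x * Real.log x ≤ y * Real.log y := by gcongr
    rw [abs_of_nonneg (by positivity)]
    linarith [le_abs_self (y * Real.log y)]

lemma toReal_rnDeriv_le_mul_of_le_smul [IsFiniteMeasure μ'] [IsFiniteMeasure ν] {c : ℝ≥0∞}
    (hc : c ≠ ∞) (hle : μ ≤ c • μ') (hac : μ' ≪ ν) :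
    ∀ᵐ a ∂ν, (μ.rnDeriv ν a).toReal ≤ c.toReal * (μ'.rnDeriv ν a).toReal := by
  have hrn : μ.rnDeriv ν ≤ᵐ[ν] fun a => c * μ'.rnDeriv ν a := by
    refine ae_le_of_forall_setLIntegral_le_of_sigmaFinite (Measure.measurable_rnDeriv _ _)
      fun s _ _ => ?_
    calc ∫⁻ a in s, μ.rnDeriv ν a ∂ν ≤ μ s := Measure.setLIntegral_rnDeriv_le s
      _ ≤ (c • μ') s := hle s
      _ = ∫⁻ a in s, c * μ'.rnDeriv ν a ∂ν := by
        rw [lintegral_const_mul _ (Measure.measurable_rnDeriv _ _),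
          Measure.setLIntegral_rnDeriv hac, Measure.smul_apply, smul_eq_mul]
  filter_upwards [hrn, Measure.rnDeriv_lt_top μ' ν] with a ha htop
  rw [← ENNReal.toReal_mul]
  exact ENNReal.toReal_mono (ENNReal.mul_ne_top hc htop.ne) ha

lemma klDiv_ne_top_of_le_smul [IsFiniteMeasure μ'] [IsFiniteMeasure ν] {c : ℝ≥0∞} (hc : c ≠ ∞)
    (hle : μ ≤ c • μ') (h : klDiv μ' ν ≠ ∞) : klDiv μ ν ≠ ∞ := by
  obtain ⟨hac', hllr'⟩ := klDiv_ne_top_iff.1 h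
  have hac : μ ≪ ν := (Measure.absolutelyContinuous_of_le_smul hle).trans hac'
  have := Measure.smul_finite μ' hc
  have : IsFiniteMeasure μ := isFiniteMeasure_of_le (c • μ') hle
  refine klDiv_ne_top hac ((integrable_rnDeriv_mul_log_iff hac).1 ?_)
  set f : α → ℝ := fun a => (μ.rnDeriv ν a).toReal
  set g : α → ℝ := fun a => (μ'.rnDeriv ν a).toReal
  have hgi : Integrable (fun a => c.toReal * g a * Real.log (c.toReal * g a)) ν := by
    have hglog := (integrable_rnDeriv_mul_log_iff hac').2 hllr'
    have hg : Integrable g ν := Measure.integrable_toReal_rnDeriv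
    refine ((hg.const_mul (c.toReal * Real.log c.toReal)).add (hglog.const_mul c.toReal)).congr
      (ae_of_all _ fun a => ?_)
    have := Real.negMulLog_mul c.toReal (g a)
    simp only [Real.negMulLog] at this
    simp only [Pi.add_apply]
    linarith
  refine ((integrable_const 1).add hgi.abs).mono' (by fun_prop) ?_
  filter_upwards [toReal_rnDeriv_le_mul_of_le_smul hc hle hac'] with a ha
  exact abs_mul_log_le_one_add_abs_mul_log ENNReal.toReal_nonneg ha

end KullbackLeibler

section LogLikelihoodRatio

variable {α : Type*} [MeasurableSpace α] {μ ν ξ : Measure α}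

lemma llr_eq_llr_add_llr [SigmaFinite μ] [SigmaFinite ν] [SigmaFinite ξ] (hμν : μ ≪ ν)
    (hνξ : ν ≪ ξ) : llr μ ξ =ᵐ[μ] fun a => llr μ ν a + llr ν ξ a := by
  filter_upwards [hμν.ae_le (Measure.rnDeriv_mul_rnDeriv' (μ := μ) hνξ), Measure.rnDeriv_pos hμν,
    hμν.ae_le (Measure.rnDeriv_lt_top μ ν), hμν.ae_le (Measure.rnDeriv_pos hνξ),
    (hμν.trans hνξ).ae_le (Measure.rnDeriv_lt_top ν ξ)] with a hmul hμ0 hμtop hν0 hνtop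
  simp only [llr_def]
  rw [← hmul, Pi.mul_apply, ENNReal.toReal_mul,
    Real.log_mul (ENNReal.toReal_pos hμ0.ne' hμtop.ne).ne'
      (ENNReal.toReal_pos hν0.ne' hνtop.ne).ne']

lemma llr_map_comp [SigmaFinite ν] [SigmaFinite ξ] {T : α ≃ᵐ α} (hT : MeasurePreserving T ξ ξ)
    (hνξ : ν ≪ ξ) : (fun a => llr (ν.map T) ξ (T a)) =ᵐ[ν] llr ν ξ := by
  filter_upwards [hνξ.ae_le (T.measurableEmbedding.rnDeriv_map ν ξ)] with a ha
  rw [hT.map_eq] at ha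
  simp only [llr_def, ha]

lemma integrable_llr_map_self [SigmaFinite ν] [SigmaFinite ξ] {T : α ≃ᵐ α}
    (hT : MeasurePreserving T ξ ξ) (hνξ : ν ≪ ξ) (hint : Integrable (llr ν ξ) ν) :
    Integrable (llr (ν.map T) ξ) (ν.map T) :=
  T.measurableEmbedding.integrable_map_iff.2 (hint.congr (llr_map_comp hT hνξ).symm)

lemma integrable_llr_map_of_klDiv_ne_top [SigmaFinite ν] [SigmaFinite ξ] {T : α ≃ᵐ α}
    (hT : MeasurePreserving T ξ ξ) (hνξ : ν ≪ ξ) (hint : Integrable (llr ν ξ) ν)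
    (hkl : klDiv (ν.map T) ν ≠ ∞) : Integrable (llr ν ξ) (ν.map T) := by
  have := T.sigmaFinite_map (μ := ν)
  obtain ⟨hac, hllr⟩ := klDiv_ne_top_iff.1 hkl
  refine ((integrable_llr_map_self hT hνξ hint).sub hllr).congr ?_
  filter_upwards [llr_eq_llr_add_llr hac hνξ] with a ha
  rw [Pi.sub_apply, ha, add_sub_cancel_left]

lemma toReal_klDiv_map_eq_sub [IsFiniteMeasure ν] [SigmaFinite ξ] {T : α ≃ᵐ α}
    (hT : MeasurePreserving T ξ ξ) (hνξ : ν ≪ ξ) (hint : Integrable (llr ν ξ) ν)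
    (hkl : klDiv (ν.map T) ν ≠ ∞) :
    (klDiv (ν.map T) ν).toReal = ∫ a, llr ν ξ a ∂ν - ∫ a, llr ν ξ a ∂(ν.map T) := by
  have hmass : ν.map T Set.univ = ν Set.univ := by rw [T.map_apply, Set.preimage_univ]
  obtain ⟨hac, hllr⟩ := klDiv_ne_top_iff.1 hkl
  have hentropy : ∫ a, llr (ν.map T) ξ a ∂(ν.map T) = ∫ a, llr ν ξ a ∂ν := by
    rw [T.measurableEmbedding.integral_map, integral_congr_ae (llr_map_comp hT hνξ)]
  rw [toReal_klDiv_of_measure_eq hac hmass, ← hentropy,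
    integral_congr_ae (llr_eq_llr_add_llr hac hνξ),
    integral_add hllr (integrable_llr_map_of_klDiv_ne_top hT hνξ hint hkl), add_sub_cancel_right]

end LogLikelihoodRatio

section ProductMeasures

variable {ι : Type*} [Fintype ι]

lemma pi_withDensity_ofReal {X : ι → Type*} [∀ i, MeasurableSpace (X i)]
    {μ : ∀ i, Measure (X i)} [∀ i, SigmaFinite (μ i)] {f : ∀ i, X i → ℝ}
    (hf : ∀ i, Integrable (f i) (μ i)) (hf0 : ∀ i x, 0 ≤ f i x) :
    Measure.pi (fun i => (μ i).withDensity fun x => ENNReal.ofReal (f i x)) =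
      (Measure.pi μ).withDensity fun x => ENNReal.ofReal (∏ i, f i (x i)) := by
  have := fun i => isFiniteMeasure_withDensity_ofReal (hf i).hasFiniteIntegral
  refine Measure.pi_eq fun s hs => ?_
  have hind0 : ∀ i x, 0 ≤ (s i).indicator (f i) x := fun i x =>
    Set.indicator_nonneg (fun x _ => hf0 i x) x
  have hprod : ∀ x : ∀ i, X i,
      (Set.univ.pi s).indicator (fun x => ENNReal.ofReal (∏ i, f i (x i))) x =
        ENNReal.ofReal (∏ i, (s i).indicator (f i) (x i)) := fun x => by
    by_cases hx : x ∈ Set.univ.pi s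
    · simp only [Set.indicator_of_mem hx, Set.indicator_of_mem (hx _ (Set.mem_univ _))]
    · obtain ⟨i, hi⟩ : ∃ i, x i ∉ s i := by simpa [Set.mem_pi] using hx
      rw [Set.indicator_of_notMem hx, Finset.prod_eq_zero (Finset.mem_univ i)
        (Set.indicator_of_notMem hi _), ENNReal.ofReal_zero]
  have hcoord : ∀ i, (μ i).withDensity (fun x => ENNReal.ofReal (f i x)) (s i) =
      ENNReal.ofReal (∫ x, (s i).indicator (f i) x ∂μ i) := fun i => by
    rw [withDensity_apply _ (hs i), integral_indicator (hs i),
      ofReal_integral_eq_lintegral_ofReal (hf i).integrableOn (ae_of_all _ (hf0 i))]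
  rw [withDensity_apply _ (MeasurableSet.univ_pi hs),
    ← lintegral_indicator (MeasurableSet.univ_pi hs), lintegral_congr hprod,
    ← ofReal_integral_eq_lintegral_ofReal
      (Integrable.fintype_prod_dep fun i => (hf i).indicator (hs i))
      (ae_of_all _ fun x => Finset.prod_nonneg fun i _ => hind0 i _),
    integral_fintype_prod_eq_prod,
    ENNReal.ofReal_prod_of_nonneg fun i _ => integral_nonneg (hind0 i)]
  exact Finset.prod_congr rfl fun i _ => (hcoord i).symm

variable {Ω : Type*} [MeasurableSpace Ω] {μ : Measure Ω} [SigmaFinite μ] {X : Ω → ℝ} {t : ℝ}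

lemma integrable_exp_mul_sum_pi (h : Integrable (fun ω => Real.exp (t * X ω)) μ) :
    Integrable (fun y : ι → Ω => Real.exp (t * ∑ i, X (y i))) (Measure.pi fun _ => μ) := by
  simp_rw [Finset.mul_sum, Real.exp_sum]
  exact Integrable.fintype_prod fun _ => h

lemma cgf_sum_pi (X : Ω → ℝ) (t : ℝ) :
    cgf (fun y : ι → Ω => ∑ i, X (y i)) (Measure.pi fun _ => μ) t =
      Fintype.card ι * cgf X μ t := by
  simp_rw [cgf, mgf, Finset.mul_sum, Real.exp_sum]
  rw [integral_fintype_prod_eq_pow fun ω => Real.exp (t * X ω), Real.log_pow]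

end ProductMeasures

section MomentGeneratingFunction

variable {Ω : Type*} [MeasurableSpace Ω] {μ : Measure Ω} {X : Ω → ℝ} {τ : ℝ}

lemma exp_sub_one_sub_id_le (u : ℝ) : Real.exp u - 1 - u ≤ u ^ 2 * (1 + Real.exp u) := by
  have hinv : Real.exp u - 1 ≤ u * Real.exp u := by
    have := mul_le_mul_of_nonneg_left (Real.one_sub_le_exp_neg u) (Real.exp_pos u).le
    rw [← Real.exp_add, add_neg_cancel, Real.exp_zero] at this
    linarith
  have hle : Real.exp u - 1 - u ≤ u * (Real.exp u - 1) := by linarith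
  refine hle.trans ?_
  rcases le_total 0 u with hu | hu
  · nlinarith [mul_le_mul_of_nonneg_left hinv hu, sq_nonneg u]
  · nlinarith [mul_le_mul_of_nonpos_left (Real.add_one_le_exp u) hu, sq_nonneg u, Real.exp_pos u]

lemma tendsto_exp_mul_sub_one_sub_div_sq (x : ℝ) :
    Tendsto (fun t : ℝ => (Real.exp (t * x) - 1 - t * x) / t ^ 2) (𝓝[>] 0) (𝓝 (x ^ 2 / 2)) := by
  have hlin : Tendsto (fun t : ℝ => t * x) (𝓝[>] 0) (𝓝 0) := by
    simpa using (tendsto_id.mul_const x).mono_left (nhdsWithin_le_nhds (a := (0 : ℝ)))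
  have htaylor : (fun t : ℝ => Real.exp (t * x) - (1 + t * x + (t * x) ^ 2 / 2))
      =o[𝓝[>] 0] fun t : ℝ => t ^ 2 := by
    have := (Real.exp_sub_sum_range_succ_isLittleO_pow 2).comp_tendsto hlin
    refine (this.trans_isBigO (Asymptotics.isBigO_of_le' (c := x ^ 2) _ fun t => ?_)).congr_left
      fun t => ?_
    · simp [mul_pow, mul_comm]
    · simp [Finset.sum_range_succ]
  have := htaylor.tendsto_div_nhds_zero.add_const (x ^ 2 / 2)
  rw [zero_add] at this
  refine this.congr' ?_
  filter_upwards [self_mem_nhdsWithin] with t ht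
  have ht0 : t ≠ 0 := (Set.mem_Ioi.1 ht).ne'
  field_simp
  ring

lemma integrable_sq_mul_exp_half [IsFiniteMeasure μ] (hτ : 0 < τ)
    (hexp : Integrable (fun ω => Real.exp (τ * X ω)) μ) :
    Integrable (fun ω => X ω ^ 2 * Real.exp (τ / 2 * X ω)) μ := by
  have := integrable_pow_abs_mul_exp_of_integrable_exp_mul (v := τ / 2) (t := τ / 2)
    (by positivity) (by simpa using hexp) (by simp) 2
  simpa only [sq_abs] using this

lemma tendsto_integral_exp_mul_sub_one_sub_div_sq [IsFiniteMeasure μ] (hX : MemLp X 2 μ)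
    (hτ : 0 < τ) (hexp : Integrable (fun ω => Real.exp (τ * X ω)) μ) :
    Tendsto (fun t => ∫ ω, (Real.exp (t * X ω) - 1 - t * X ω) / t ^ 2 ∂μ) (𝓝[>] 0)
      (𝓝 (∫ ω, X ω ^ 2 / 2 ∂μ)) := by
  have hXm := hX.aestronglyMeasurable.aemeasurable
  refine tendsto_integral_filter_of_dominated_convergence
    (fun ω => 2 * X ω ^ 2 + X ω ^ 2 * Real.exp (τ / 2 * X ω))
    (Eventually.of_forall fun t => by fun_prop) ?_
    ((hX.integrable_sq.const_mul 2).add (integrable_sq_mul_exp_half hτ hexp))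
    (ae_of_all _ fun ω => tendsto_exp_mul_sub_one_sub_div_sq (X ω))
  filter_upwards [Ioc_mem_nhdsGT (half_pos hτ)] with t ⟨ht0, htτ⟩
  refine ae_of_all _ fun ω => ?_
  have hexp_le : Real.exp (t * X ω) ≤ 1 + Real.exp (τ / 2 * X ω) := by
    rcases le_total 0 (X ω) with h | h
    · linarith [Real.exp_le_exp.2 (mul_le_mul_of_nonneg_right htτ h)]
    · linarith [Real.exp_le_one_iff.2 (mul_nonpos_of_nonneg_of_nonpos ht0.le h),
        Real.exp_pos (τ / 2 * X ω)]
  have hnonneg : 0 ≤ Real.exp (t * X ω) - 1 - t * X ω := by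
    linarith [Real.add_one_le_exp (t * X ω)]
  rw [Real.norm_of_nonneg (by positivity), div_le_iff₀ (by positivity)]
  calc Real.exp (t * X ω) - 1 - t * X ω
      ≤ (t * X ω) ^ 2 * (1 + (1 + Real.exp (τ / 2 * X ω))) :=
        (exp_sub_one_sub_id_le _).trans (by gcongr)
    _ = (2 * X ω ^ 2 + X ω ^ 2 * Real.exp (τ / 2 * X ω)) * t ^ 2 := by ring

lemma tendsto_mgf_sub_one_div_sq [IsProbabilityMeasure μ] (hX : MemLp X 2 μ) (hX0 : μ[X] = 0)
    (hτ : 0 < τ) (hexp : Integrable (fun ω => Real.exp (τ * X ω)) μ) :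
    Tendsto (fun t => (mgf X μ t - 1) / t ^ 2) (𝓝[>] 0) (𝓝 (variance X μ / 2)) := by
  have hlim := tendsto_integral_exp_mul_sub_one_sub_div_sq hX hτ hexp
  rw [integral_div, ← variance_of_integral_eq_zero hX.aestronglyMeasurable.aemeasurable hX0] at hlim
  refine hlim.congr' ?_
  filter_upwards [Ioc_mem_nhdsGT hτ] with t ⟨ht0, htτ⟩
  have hint : Integrable (fun ω => Real.exp (t * X ω)) μ :=
    integrable_exp_mul_of_nonneg_of_le hexp ht0.le htτ
  have hint' : Integrable (fun ω => Real.exp (t * X ω) - 1) μ := hint.sub (integrable_const 1)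
  rw [integral_div, integral_sub hint' ((hX.integrable one_le_two).const_mul t),
    integral_sub hint (integrable_const 1), integral_const_mul, hX0, mgf]
  simp

lemma cgf_le_mgf_sub_one [NeZero μ] {t : ℝ} (hexp : Integrable (fun ω => Real.exp (t * X ω)) μ) :
    cgf X μ t ≤ mgf X μ t - 1 :=
  Real.log_le_sub_one_of_pos (mgf_pos' (NeZero.ne μ) hexp)

end MomentGeneratingFunction

section Noise

variable {p : ℝ → ℝ}

lemma IsPDF.isProbabilityMeasure (hp : IsPDF p) : IsProbabilityMeasure (noise p) :=
  ⟨by rw [noise, withDensity_apply _ MeasurableSet.univ, Measure.restrict_univ,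
    hp.lintegral_eq_one]⟩

lemma IsPDF.integrable (hp : IsPDF p) : Integrable p volume :=
  (lintegral_ofReal_ne_top_iff_integrable hp.aemeasurable.aestronglyMeasurable
    (ae_of_all _ hp.nonneg)).1 (by rw [hp.lintegral_eq_one]; exact ENNReal.one_ne_top)

lemma noise_absolutelyContinuous (p : ℝ → ℝ) : noise p ≪ volume :=
  withDensity_absolutelyContinuous _ _

lemma IsPDF.aemeasurable_log (hp : IsPDF p) : AEMeasurable (fun z => Real.log (p z)) (noise p) :=
  (hp.aemeasurable.mono_ac (noise_absolutelyContinuous p)).log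

lemma IsPDF.integrable_noise_iff (hp : IsPDF p) {f : ℝ → ℝ} :
    Integrable f (noise p) ↔ Integrable (fun z => p z * f z) volume := by
  rw [noise, integrable_withDensity_iff_integrable_smul₀' hp.aemeasurable.ennreal_ofReal
    (by simp)]
  simp only [ENNReal.toReal_ofReal (hp.nonneg _), smul_eq_mul]

lemma IsPDF.isProbabilityMeasure_noiseVec (hp : IsPDF p) (n : ℕ) :
    IsProbabilityMeasure (noiseVec p n) := by
  have := hp.isProbabilityMeasure
  unfold noiseVec
  infer_instance

lemma IsPDF.isProbabilityMeasure_channelLaw (hp : IsPDF p) {n : ℕ} (x : Fin n → ℝ) :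
    IsProbabilityMeasure (channelLaw p x) := by
  have := hp.isProbabilityMeasure_noiseVec n
  exact Measure.isProbabilityMeasure_map (by fun_prop)

lemma IsPDF.noiseVec_eq_withDensity (hp : IsPDF p) (n : ℕ) :
    noiseVec p n = volume.withDensity fun y => ENNReal.ofReal (∏ i, p (y i)) := by
  rw [volume_pi]
  exact pi_withDensity_ofReal (fun _ => hp.integrable) fun _ => hp.nonneg

lemma IsPDF.noiseVec_absolutelyContinuous (hp : IsPDF p) (n : ℕ) : noiseVec p n ≪ volume := by
  rw [hp.noiseVec_eq_withDensity]
  exact withDensity_absolutelyContinuous _ _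

lemma IsPDF.llr_noiseVec (hp : IsPDF p) (n : ℕ) :
    llr (noiseVec p n) volume =ᵐ[noiseVec p n] fun y => ∑ i, Real.log (p (y i)) := by
  have := hp.isProbabilityMeasure_noiseVec n
  have hac := hp.noiseVec_absolutelyContinuous n
  have hprod : AEMeasurable (fun y : Fin n → ℝ => ENNReal.ofReal (∏ i, p (y i))) volume :=
    (Finset.aemeasurable_fun_prod _ fun i _ => hp.aemeasurable.comp_quasiMeasurePreserving
      (Measure.quasiMeasurePreserving_eval _ i)).ennreal_ofReal
  have hrn : (noiseVec p n).rnDeriv volume =ᵐ[volume] fun y => ENNReal.ofReal (∏ i, p (y i)) := by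
    rw [hp.noiseVec_eq_withDensity]
    exact Measure.rnDeriv_withDensity₀ _ hprod
  filter_upwards [hac.ae_le hrn, Measure.rnDeriv_pos hac] with y hy hpos
  rw [hy, ENNReal.ofReal_pos] at hpos
  simp only [llr_def]
  rw [hy, ENNReal.toReal_ofReal hpos.le,
    Real.log_prod fun i hi => Finset.prod_ne_zero_iff.1 hpos.ne' i hi]

/-- The centred information density `-log p(z) - h(Z)` of one noise symbol, where
`h(Z) = -∫ p log p` is the differential entropy. -/
noncomputable def excess (p : ℝ → ℝ) (z : ℝ) : ℝ :=
  (∫ w, Real.log (p w) ∂noise p) - Real.log (p z)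

/-- The sum of `excess p` over the coordinates of `y`, i.e. `-log p^n(y) - h(Z^n)`. -/
noncomputable def excessSum (p : ℝ → ℝ) {n : ℕ} (y : Fin n → ℝ) : ℝ :=
  ∑ i, excess p (y i)

variable {n : ℕ}

lemma IsPDF.integrable_excess (hp : IsPDF p)
    (hlog : Integrable (fun z => Real.log (p z)) (noise p)) : Integrable (excess p) (noise p) := by
  have := hp.isProbabilityMeasure
  exact (integrable_const _).sub hlog

lemma IsPDF.integral_excess (hp : IsPDF p)
    (hlog : Integrable (fun z => Real.log (p z)) (noise p)) : ∫ z, excess p z ∂noise p = 0 := by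
  have := hp.isProbabilityMeasure
  simp only [excess]
  rw [integral_sub (integrable_const _) hlog]
  simp

lemma IsPDF.integrable_excessSum (hp : IsPDF p)
    (hlog : Integrable (fun z => Real.log (p z)) (noise p)) :
    Integrable (excessSum p) (noiseVec p n) := by
  have := hp.isProbabilityMeasure
  exact integrable_finsetSum _ fun i _ => integrable_comp_eval (i := i) (hp.integrable_excess hlog)

lemma IsPDF.integral_excessSum (hp : IsPDF p)
    (hlog : Integrable (fun z => Real.log (p z)) (noise p)) :
    ∫ y, excessSum p y ∂noiseVec p n = 0 := by
  have := hp.isProbabilityMeasure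
  have hint := hp.integrable_excess hlog
  simp only [excessSum, noiseVec]
  rw [integral_finsetSum _ fun i _ => integrable_comp_eval (i := i) hint]
  refine Finset.sum_eq_zero fun i _ => ?_
  rw [integral_comp_eval (i := i) hint.aestronglyMeasurable, hp.integral_excess hlog]

lemma IsPDF.llr_noiseVec_eq_sub_excessSum (hp : IsPDF p) (n : ℕ) :
    llr (noiseVec p n) volume =ᵐ[noiseVec p n]
      fun y => n * ∫ w, Real.log (p w) ∂noise p - excessSum p y := by
  filter_upwards [hp.llr_noiseVec n] with y hy
  simp [hy, excessSum, excess]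

lemma IsPDF.integrable_llr_noiseVec (hp : IsPDF p)
    (hlog : Integrable (fun z => Real.log (p z)) (noise p)) :
    Integrable (llr (noiseVec p n) volume) (noiseVec p n) := by
  have := hp.isProbabilityMeasure_noiseVec n
  exact ((integrable_const _).sub (hp.integrable_excessSum hlog)).congr
    (hp.llr_noiseVec_eq_sub_excessSum n).symm

variable {x : Fin n → ℝ}

lemma IsPDF.integrable_excessSum_channelLaw (hp : IsPDF p)
    (hlog : Integrable (fun z => Real.log (p z)) (noise p))
    (hkl : klDiv (channelLaw p x) (noiseVec p n) ≠ ∞) :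
    Integrable (excessSum p) (channelLaw p x) := by
  have := hp.isProbabilityMeasure_noiseVec n
  have := hp.isProbabilityMeasure_channelLaw x
  have hllr : Integrable (llr (noiseVec p n) volume) (channelLaw p x) :=
    integrable_llr_map_of_klDiv_ne_top (T := MeasurableEquiv.addLeft x)
      (measurePreserving_add_left volume x) (hp.noiseVec_absolutelyContinuous n)
      (hp.integrable_llr_noiseVec hlog) hkl
  refine ((integrable_const (n * ∫ w, Real.log (p w) ∂noise p)).sub hllr).congr ?_
  filter_upwards [(klDiv_ne_top_iff.1 hkl).1.ae_le (hp.llr_noiseVec_eq_sub_excessSum n)] with y hy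
  rw [Pi.sub_apply, hy, sub_sub_cancel]

lemma IsPDF.toReal_klDiv_channelLaw (hp : IsPDF p)
    (hlog : Integrable (fun z => Real.log (p z)) (noise p))
    (hkl : klDiv (channelLaw p x) (noiseVec p n) ≠ ∞) :
    (klDiv (channelLaw p x) (noiseVec p n)).toReal = ∫ y, excessSum p y ∂channelLaw p x := by
  have := hp.isProbabilityMeasure_noiseVec n
  have := hp.isProbabilityMeasure_channelLaw x
  have hkl_eq : (klDiv (channelLaw p x) (noiseVec p n)).toReal =
      ∫ y, llr (noiseVec p n) volume y ∂noiseVec p n -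
        ∫ y, llr (noiseVec p n) volume y ∂channelLaw p x :=
    toReal_klDiv_map_eq_sub (T := MeasurableEquiv.addLeft x)
      (measurePreserving_add_left volume x) (hp.noiseVec_absolutelyContinuous n)
      (hp.integrable_llr_noiseVec hlog) hkl
  have hae := hp.llr_noiseVec_eq_sub_excessSum n
  rw [hkl_eq, integral_congr_ae hae, integral_congr_ae ((klDiv_ne_top_iff.1 hkl).1.ae_le hae),
    integral_sub (integrable_const _) (hp.integrable_excessSum hlog), hp.integral_excessSum hlog,
    integral_sub (integrable_const _) (hp.integrable_excessSum_channelLaw hlog hkl)]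
  simp

end Noise

namespace Code

variable {p : ℝ → ℝ} {n M K : ℕ} {Δ ε t : ℝ}

lemma isProbabilityMeasure_outputLaw (hp : IsPDF p) (hM : 0 < M) (hK : 0 < K) (c : Code n M K) :
    IsProbabilityMeasure (c.outputLaw p) := by
  have := fun m k => hp.isProbabilityMeasure_channelLaw (c.enc m k)
  refine ⟨?_⟩
  simp only [outputLaw, Measure.smul_apply, Measure.finsetSum_apply, measure_univ,
    Finset.sum_const, Finset.card_univ, Fintype.card_fin, smul_eq_mul, nsmul_eq_mul, mul_one]
  rw [mul_comm (M : ℝ≥0∞)]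
  exact ENNReal.inv_mul_cancel (by simp [hM.ne', hK.ne']) (by finiteness)

lemma integrable_outputLaw (hM : 0 < M) (hK : 0 < K) (c : Code n M K) {f : (Fin n → ℝ) → ℝ}
    (hf : ∀ m k, Integrable f (channelLaw p (c.enc m k))) : Integrable f (c.outputLaw p) :=
  (integrable_finsetSum_measure.2 fun m _ =>
    integrable_finsetSum_measure.2 fun k _ => hf m k).smul_measure (by simp [hM.ne', hK.ne'])

lemma integral_outputLaw (c : Code n M K) {f : (Fin n → ℝ) → ℝ}
    (hf : ∀ m k, Integrable f (channelLaw p (c.enc m k))) :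
    ∫ y, f y ∂(c.outputLaw p) =
      ((K : ℝ) * M)⁻¹ * ∑ m, ∑ k, ∫ y, f y ∂(channelLaw p (c.enc m k)) := by
  rw [outputLaw, integral_smul_measure, integral_finsetSum_measure fun m _ =>
    integrable_finsetSum_measure.2 fun k _ => hf m k, smul_eq_mul]
  congr 1
  · simp
  · exact Finset.sum_congr rfl fun m _ => integral_finsetSum_measure fun k _ => hf m k

lemma channelLaw_le (c : Code n M K) (m : Fin M) (k : Fin K) :
    channelLaw p (c.enc m k) ≤ ((K : ℝ≥0∞) * M) • c.outputLaw p := by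
  have hKM : (K : ℝ≥0∞) * M ≠ 0 := by simp [k.pos.ne', m.pos.ne']
  rw [outputLaw, smul_smul, ENNReal.mul_inv_cancel hKM (by finiteness), one_smul]
  intro s
  simp only [Measure.finsetSum_apply]
  exact (Finset.single_le_sum (f := fun k => channelLaw p (c.enc m k) s)
    (fun _ _ => zero_le) (Finset.mem_univ k)).trans
    (Finset.single_le_sum (f := fun m => ∑ k, channelLaw p (c.enc m k) s)
    (fun _ _ => zero_le) (Finset.mem_univ m))

lemma klDiv_channelLaw_ne_top (hp : IsPDF p) (c : Code n M K)
    (hkl : klDiv (c.outputLaw p) (noiseVec p n) ≠ ∞) (m : Fin M) (k : Fin K) :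
    klDiv (channelLaw p (c.enc m k)) (noiseVec p n) ≠ ∞ := by
  have := hp.isProbabilityMeasure_noiseVec n
  have := c.isProbabilityMeasure_outputLaw hp m.pos k.pos
  exact klDiv_ne_top_of_le_smul (by finiteness) (c.channelLaw_le m k) hkl

/-- The probability of correct decoding, averaged over a uniform message and an independent
uniform key. -/
noncomputable def avgSuccess (c : Code n M K) (p : ℝ → ℝ) : ℝ :=
  ((K : ℝ) * M)⁻¹ * ∑ m, ∑ k, (channelLaw p (c.enc m k)).real {y | c.dec y k = m}

lemma avgSuccess_add_toReal_avgError (hp : IsPDF p) (hM : 0 < M) (hK : 0 < K) (c : Code n M K) :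
    c.avgSuccess p + (c.avgError p).toReal = 1 := by
  have := fun m k => hp.isProbabilityMeasure_channelLaw (c.enc m k)
  have herr : (c.avgError p).toReal =
      ((K : ℝ) * M)⁻¹ * ∑ m, ∑ k, (channelLaw p (c.enc m k)).real {y | c.dec y k ≠ m} := by
    rw [avgError, ENNReal.toReal_mul, ENNReal.toReal_sum fun m _ =>
      ENNReal.sum_ne_top.2 fun k _ => measure_ne_top _ _]
    congr 1
    · simp
    · exact Finset.sum_congr rfl fun m _ => ENNReal.toReal_sum fun k _ => measure_ne_top _ _
  have hcompl : ∀ m k, (channelLaw p (c.enc m k)).real {y | c.dec y k = m} +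
      (channelLaw p (c.enc m k)).real {y | c.dec y k ≠ m} = 1 := fun m k =>
    probReal_add_probReal_compl (c.measurable_dec k (measurableSet_singleton m))
  rw [herr, avgSuccess, ← mul_add]
  simp only [← Finset.sum_add_distrib, hcompl, Finset.sum_const, Finset.card_univ,
    Fintype.card_fin, nsmul_eq_mul, mul_one]
  rw [mul_comm (M : ℝ), inv_mul_cancel₀ (by positivity)]

lemma avgSuccess_mul_log_le (hp : IsPDF p)
    (hlog : Integrable (fun z => Real.log (p z)) (noise p)) (hM : 0 < M) (hK : 0 < K)
    (c : Code n M K) (hkl : klDiv (c.outputLaw p) (noiseVec p n) ≠ ∞) :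
    c.avgSuccess p * Real.log M ≤ ∫ y, excessSum p y ∂c.outputLaw p + 1 := by
  have := hp.isProbabilityMeasure_noiseVec n
  have := fun m k => hp.isProbabilityMeasure_channelLaw (c.enc m k)
  have hkl' := c.klDiv_channelLaw_ne_top hp hkl
  have hfano : ∀ k, (∑ m, (channelLaw p (c.enc m k)).real {y | c.dec y k = m}) * Real.log M ≤
      ∑ m, ∫ y, excessSum p y ∂channelLaw p (c.enc m k) + M := fun k => by
    simpa only [Fintype.card_fin, hp.toReal_klDiv_channelLaw hlog (hkl' _ k)] using
      sum_measureReal_mul_log_card_le (fun m => hkl' m k) (c.measurable_dec k)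
  have hKM : (0 : ℝ) < K * M := by positivity
  rw [avgSuccess, c.integral_outputLaw fun m k =>
    hp.integrable_excessSum_channelLaw hlog (hkl' m k), mul_assoc, inv_mul_le_iff₀ hKM, mul_add,
    mul_inv_cancel_left₀ hKM.ne', mul_one, Finset.sum_comm, Finset.sum_mul]
  refine (Finset.sum_le_sum fun k _ => hfano k).trans (le_of_eq ?_)
  rw [Finset.sum_add_distrib, Finset.sum_comm]
  simp

lemma mul_integral_excessSum_outputLaw_le (hp : IsPDF p)
    (hlog : Integrable (fun z => Real.log (p z)) (noise p))
    (hexp : Integrable (fun z => Real.exp (t * excess p z)) (noise p)) (hM : 0 < M) (hK : 0 < K)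
    (c : Code n M K) (hkl : klDiv (c.outputLaw p) (noiseVec p n) ≠ ∞) :
    t * ∫ y, excessSum p y ∂c.outputLaw p ≤
      (klDiv (c.outputLaw p) (noiseVec p n)).toReal + n * cgf (excess p) (noise p) t := by
  have := hp.isProbabilityMeasure
  have := hp.isProbabilityMeasure_noiseVec n
  have := c.isProbabilityMeasure_outputLaw hp hM hK
  have hcgf : Real.log (∫ y, Real.exp (t * excessSum p y) ∂noiseVec p n) =
      n * cgf (excess p) (noise p) t :=
    (cgf_sum_pi (excess p) t).trans (by rw [Fintype.card_fin])
  have hint : Integrable (excessSum p) (c.outputLaw p) := c.integrable_outputLaw hM hK fun m k =>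
    hp.integrable_excessSum_channelLaw hlog (c.klDiv_channelLaw_ne_top hp hkl m k)
  rw [← hcgf, ← integral_const_mul]
  exact integral_le_toReal_klDiv_add_log_integral_exp hkl (hint.const_mul t)
    (integrable_exp_mul_sum_pi hexp)

theorem one_sub_mul_log_le (hp : IsPDF p)
    (hlog : Integrable (fun z => Real.log (p z)) (noise p)) (ht : 0 < t)
    (hexp : Integrable (fun z => Real.exp (t * excess p z)) (noise p)) (hM : 0 < M) (hK : 0 < K)
    (c : Code n M K) (hΔ : 0 ≤ Δ) (hcov : c.IsCovert p Δ) (hε : 0 ≤ ε)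
    (herr : c.avgError p ≤ ENNReal.ofReal ε) :
    (1 - ε) * Real.log M ≤ 1 + (Δ + n * cgf (excess p) (noise p) t) / t := by
  have hkl : klDiv (c.outputLaw p) (noiseVec p n) ≠ ∞ := ne_top_of_le_ne_top (by simp) hcov
  have hsuccess : 1 - ε ≤ c.avgSuccess p := by
    linarith [c.avgSuccess_add_toReal_avgError hp hM hK, ENNReal.toReal_le_of_le_ofReal hε herr]
  have hexcess : ∫ y, excessSum p y ∂c.outputLaw p ≤
      (Δ + n * cgf (excess p) (noise p) t) / t := by
    rw [le_div_iff₀' ht]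
    linarith [c.mul_integral_excessSum_outputLaw_le hp hlog hexp hM hK hkl,
      ENNReal.toReal_le_of_le_ofReal hΔ hcov]
  calc (1 - ε) * Real.log M ≤ c.avgSuccess p * Real.log M := by
        gcongr
    _ ≤ ∫ y, excessSum p y ∂c.outputLaw p + 1 := c.avgSuccess_mul_log_le hp hlog hM hK hkl
    _ ≤ 1 + (Δ + n * cgf (excess p) (noise p) t) / t := by linarith

end Code

section NoiseMoments

variable {p : ℝ → ℝ}

lemma mul_exp_one_sub_mul_neg_log {a ζ : ℝ} (ha : 0 ≤ a) (hζ : ζ ≠ 0) :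
    a * Real.exp ((1 - ζ) * -Real.log a) = a ^ ζ := by
  rcases ha.eq_or_lt with rfl | ha
  · simp [Real.zero_rpow hζ]
  · nth_rewrite 1 [Real.rpow_def_of_pos ha, ← Real.exp_log ha]
    rw [← Real.exp_add]
    ring_nf

lemma IsPDF.integrable_mul_log_sq (hp : IsPDF p)
    (h : Integrable (fun z => p z * Real.log (p z) ^ 4) volume) :
    Integrable (fun z => p z * Real.log (p z) ^ 2) volume := by
  have hpm := hp.aemeasurable
  refine (hp.integrable.add h).mono' (by fun_prop) (ae_of_all _ fun z => ?_)
  have hz := hp.nonneg z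
  rw [Real.norm_of_nonneg (by positivity), Pi.add_apply]
  nlinarith [mul_nonneg hz (sq_nonneg (Real.log (p z) ^ 2 - 1)),
    mul_nonneg hz (sq_nonneg (Real.log (p z)))]

lemma IsPDF.memLp_log (hp : IsPDF p)
    (h : Integrable (fun z => p z * Real.log (p z) ^ 2) volume) :
    MemLp (fun z => Real.log (p z)) 2 (noise p) :=
  (memLp_two_iff_integrable_sq hp.aemeasurable_log.aestronglyMeasurable).2
    (hp.integrable_noise_iff.2 h)

lemma IsPDF.integrable_exp_excess (hp : IsPDF p) {ζ : ℝ} (hζ : ζ ≠ 0)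
    (h : Integrable (fun z => p z ^ ζ) volume) :
    Integrable (fun z => Real.exp ((1 - ζ) * excess p z)) (noise p) := by
  have hexp : Integrable (fun z => Real.exp ((1 - ζ) * -Real.log (p z))) (noise p) := by
    rw [hp.integrable_noise_iff]
    simpa only [mul_exp_one_sub_mul_neg_log (hp.nonneg _) hζ] using h
  simpa only [excess, ← Real.exp_add, ← mul_add, ← sub_eq_add_neg] using
    hexp.const_mul (Real.exp ((1 - ζ) * ∫ w, Real.log (p w) ∂noise p))

lemma IsPDF.memLp_excess (hp : IsPDF p) (h : MemLp (fun z => Real.log (p z)) 2 (noise p)) :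
    MemLp (excess p) 2 (noise p) := by
  have := hp.isProbabilityMeasure
  exact (memLp_const _).sub h

lemma IsPDF.variance_excess (hp : IsPDF p) :
    variance (excess p) (noise p) = variance (fun z => Real.log (p z)) (noise p) := by
  have := hp.isProbabilityMeasure
  exact variance_const_sub hp.aemeasurable_log.aestronglyMeasurable _

end NoiseMoments

section Scaling

variable {p : ℝ → ℝ} {Δ ε : ℝ}

lemma maxLogMessages_mono (p : ℝ → ℝ) (Δ : ℝ) (n : ℕ) :
    Monotone fun ε => maxLogMessages p Δ ε n := by
  intro ε ε' h
  refine sSup_le_sSup ?_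
  rintro a ⟨M, K, hM, hK, ha, c, hcov, herr⟩
  exact ⟨M, K, hM, hK, ha, c, hcov, herr.trans (ENNReal.ofReal_le_ofReal h)⟩

lemma scalingAt_mono (p : ℝ → ℝ) (Δ : ℝ) : Monotone (scalingAt p Δ) := fun _ _ h =>
  liminf_le_liminf (Eventually.of_forall fun n =>
    EReal.div_le_div_right_of_nonneg (EReal.coe_nonneg.2 (Real.sqrt_nonneg _))
      (maxLogMessages_mono p Δ n h))

lemma tendsto_scalingAt (p : ℝ → ℝ) (Δ : ℝ) :
    Tendsto (fun ε => scalingAt p Δ ε) (𝓝[>] (0 : ℝ)) (𝓝 (scalingConstant p Δ)) :=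
  tendsto_nhds_limUnder ⟨_, (scalingAt_mono p Δ).tendsto_nhdsGT 0⟩

lemma maxLogMessages_nonneg (hp : IsPDF p) (Δ ε : ℝ) (n : ℕ) : 0 ≤ maxLogMessages p Δ ε n := by
  have := hp.isProbabilityMeasure_noiseVec n
  refine le_sSup ⟨1, 1, one_pos, one_pos, by simp, ⟨fun _ _ => 0, fun _ _ => 0, fun _ =>
    measurable_const⟩, ?_, ?_⟩
  · simp [Code.IsCovert, Code.outputLaw, channelLaw]
  · simp [Code.avgError]

lemma scalingAt_nonneg (hp : IsPDF p) (Δ ε : ℝ) : 0 ≤ scalingAt p Δ ε :=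
  le_liminf_of_le (by isBoundedDefault) (Eventually.of_forall fun n =>
    EReal.div_nonneg (maxLogMessages_nonneg hp Δ ε n) (EReal.coe_nonneg.2 (Real.sqrt_nonneg _)))

lemma scalingConstant_nonneg (hp : IsPDF p) (Δ : ℝ) : 0 ≤ scalingConstant p Δ :=
  ge_of_tendsto' (tendsto_scalingAt p Δ) fun ε => scalingAt_nonneg hp Δ ε

lemma maxLogMessages_le (hp : IsPDF p) (hlog : Integrable (fun z => Real.log (p z)) (noise p))
    (hΔ : 0 ≤ Δ) (hε : 0 ≤ ε) (hε1 : ε < 1) {t : ℝ} (ht : 0 < t)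
    (hexp : Integrable (fun z => Real.exp (t * excess p z)) (noise p)) (n : ℕ) :
    maxLogMessages p Δ ε n ≤
      (((1 + (Δ + n * cgf (excess p) (noise p) t) / t) / (1 - ε) : ℝ) : EReal) := by
  refine sSup_le ?_
  rintro a ⟨M, K, hM, hK, rfl, c, hcov, herr⟩
  rw [EReal.coe_le_coe_iff, le_div_iff₀' (by linarith)]
  exact c.one_sub_mul_log_le hp hlog ht hexp hM hK hΔ hcov hε herr

lemma maxLogMessages_div_sqrt_le (hp : IsPDF p)
    (hlog : Integrable (fun z => Real.log (p z)) (noise p)) (hΔ : 0 < Δ) (hε : 0 ≤ ε)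
    (hε1 : ε < 1) {s t : ℝ} (hs : 0 < s) {n : ℕ} (hn : 0 < n) (ht : t = s * (√(n * Δ) / n))
    (hexp : Integrable (fun z => Real.exp (t * excess p z)) (noise p)) :
    maxLogMessages p Δ ε n / ((√(n * Δ) : ℝ) : EReal) ≤
      (((1 / √(n * Δ) + 1 / s + s * ((mgf (excess p) (noise p) t - 1) / t ^ 2)) / (1 - ε) : ℝ)
        : EReal) := by
  have := hp.isProbabilityMeasure
  have hn' : (0 : ℝ) < n := by exact_mod_cast hn
  set q := √(n * Δ)
  have hq : 0 < q := Real.sqrt_pos.2 (by positivity)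
  have ht0 : 0 < t := by rw [ht]; positivity
  have hΔ_eq : Δ = q ^ 2 / n := by rw [Real.sq_sqrt (by positivity)]; field_simp
  have hreal : (1 + (Δ + n * cgf (excess p) (noise p) t) / t) / (1 - ε) / q ≤
      (1 / q + 1 / s + s * ((mgf (excess p) (noise p) t - 1) / t ^ 2)) / (1 - ε) := by
    rw [div_right_comm]
    refine div_le_div_of_nonneg_right ?_ (by linarith)
    calc (1 + (Δ + n * cgf (excess p) (noise p) t) / t) / q
        ≤ (1 + (Δ + n * (mgf (excess p) (noise p) t - 1)) / t) / q := by
          gcongr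
          exact cgf_le_mgf_sub_one hexp
      _ = 1 / q + 1 / s + s * ((mgf (excess p) (noise p) t - 1) / t ^ 2) := by
          rw [hΔ_eq, ht]
          field_simp
          ring
  refine (EReal.div_le_div_right_of_nonneg (EReal.coe_nonneg.2 hq.le)
    (maxLogMessages_le hp hlog hΔ.le hε hε1 ht0 hexp n)).trans ?_
  rw [← EReal.coe_div]
  exact EReal.coe_le_coe_iff.2 hreal

lemma tendsto_sqrt_natCast_mul (hΔ : 0 < Δ) :
    Tendsto (fun n : ℕ => √(n * Δ)) atTop atTop :=
  Real.tendsto_sqrt_atTop.comp (tendsto_natCast_atTop_atTop.atTop_mul_const hΔ)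

lemma tendsto_mul_sqrt_natCast_mul_div (hΔ : 0 < Δ) {s : ℝ} (hs : 0 < s) :
    Tendsto (fun n : ℕ => s * (√(n * Δ) / n)) atTop (𝓝[>] 0) := by
  have hlim : Tendsto (fun n : ℕ => s * Δ / √(n * Δ)) atTop (𝓝 0) :=
    tendsto_const_nhds.div_atTop (tendsto_sqrt_natCast_mul hΔ)
  refine tendsto_nhdsWithin_iff.2 ⟨hlim.congr' ?_, ?_⟩ <;>
    filter_upwards [eventually_gt_atTop 0] with n hn <;>
    have hn' : (0 : ℝ) < n := by exact_mod_cast hn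
  · rw [← mul_div_assoc, div_eq_div_iff (by positivity) hn'.ne', mul_assoc s (√_),
      Real.mul_self_sqrt (by positivity)]
    ring
  · exact Set.mem_Ioi.2 (by positivity)

lemma scalingAt_le (hp : IsPDF p) (hlog : MemLp (fun z => Real.log (p z)) 2 (noise p)) {τ : ℝ}
    (hτ : 0 < τ) (hexp : Integrable (fun z => Real.exp (τ * excess p z)) (noise p))
    (hΔ : 0 < Δ) (hε : 0 ≤ ε) (hε1 : ε < 1) {s : ℝ} (hs : 0 < s) :
    scalingAt p Δ ε ≤
      (((1 / s + s / 2 * variance (fun z => Real.log (p z)) (noise p)) / (1 - ε) : ℝ) : EReal) := by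
  have := hp.isProbabilityMeasure
  have hlog1 := hlog.integrable one_le_two
  set t : ℕ → ℝ := fun n => s * (√(n * Δ) / n)
  have ht : Tendsto t atTop (𝓝[>] 0) := tendsto_mul_sqrt_natCast_mul_div hΔ hs
  have hmgf : Tendsto (fun n => (mgf (excess p) (noise p) (t n) - 1) / t n ^ 2) atTop
      (𝓝 (variance (excess p) (noise p) / 2)) :=
    (tendsto_mgf_sub_one_div_sq (hp.memLp_excess hlog) (hp.integral_excess hlog1) hτ hexp).comp
      ht
  have hlim : Tendsto (fun n : ℕ => (1 / √(n * Δ) + 1 / s +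
      s * ((mgf (excess p) (noise p) (t n) - 1) / t n ^ 2)) / (1 - ε)) atTop
      (𝓝 ((1 / s + s / 2 * variance (excess p) (noise p)) / (1 - ε))) := by
    have h0 : Tendsto (fun n : ℕ => 1 / √(n * Δ)) atTop (𝓝 0) :=
      tendsto_const_nhds.div_atTop (tendsto_sqrt_natCast_mul hΔ)
    convert ((h0.add_const (1 / s)).add (hmgf.const_mul s)).div_const (1 - ε) using 2
    ring_nf
  rw [← hp.variance_excess, ← (EReal.tendsto_coe.2 hlim).liminf_eq]
  refine liminf_le_liminf ?_
  filter_upwards [eventually_gt_atTop 0, ht (Ioc_mem_nhdsGT hτ)] with n hn ⟨hn0, hnτ⟩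
  exact maxLogMessages_div_sqrt_le hp hlog1 hΔ hε hε1 hs hn rfl
    (integrable_exp_mul_of_nonneg_of_le hexp hn0.le hnτ)

lemma scalingConstant_le_of_forall_scalingAt_le {B : ℝ}
    (h : ∀ ε : ℝ, 0 ≤ ε → ε < 1 → scalingAt p Δ ε ≤ ((B / (1 - ε) : ℝ) : EReal)) :
    scalingConstant p Δ ≤ (B : EReal) := by
  have hlim : Tendsto (fun ε : ℝ => B / (1 - ε)) (𝓝[>] 0) (𝓝 (B / (1 - 0))) :=
    (tendsto_const_nhds.div (tendsto_const_nhds.sub tendsto_id) (by norm_num)).mono_left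
      nhdsWithin_le_nhds
  rw [sub_zero, div_one] at hlim
  refine le_of_tendsto_of_tendsto (tendsto_scalingAt p Δ) (EReal.tendsto_coe.2 hlim) ?_
  filter_upwards [Ioo_mem_nhdsGT (zero_lt_one' ℝ)] with ε hε
  exact h ε hε.1.le hε.2

lemma le_sqrt_two_mul_sqrt_of_forall {L : EReal} {V : ℝ} (hV : 0 ≤ V)
    (h : ∀ s : ℝ, 0 < s → L ≤ ((1 / s + s / 2 * V : ℝ) : EReal)) :
    L ≤ ((√2 * √V : ℝ) : EReal) := by
  rcases hV.eq_or_lt with rfl | hV'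
  · have hlim : Tendsto (fun s : ℝ => 1 / s) atTop (𝓝 0) :=
      tendsto_const_nhds.div_atTop tendsto_id
    have := ge_of_tendsto (EReal.tendsto_coe.2 hlim) ((eventually_gt_atTop 0).mono fun s hs => by
      simpa using h s hs)
    simpa using this
  · have hv : 0 < √V := Real.sqrt_pos.2 hV'
    have hopt : 1 / (√2 / √V) + √2 / √V / 2 * V = √2 * √V := by
      nth_rewrite 3 [← Real.sq_sqrt hV]
      have h2 : √(2 : ℝ) ^ 2 = 2 := Real.sq_sqrt (by norm_num)
      field_simp
      linarith
    rw [← hopt]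
    exact h (√2 / √V) (by positivity)

theorem scalingConstant_le (hp : IsPDF p) (hlog : MemLp (fun z => Real.log (p z)) 2 (noise p))
    {τ : ℝ} (hτ : 0 < τ) (hexp : Integrable (fun z => Real.exp (τ * excess p z)) (noise p))
    (hΔ : 0 < Δ) :
    scalingConstant p Δ ≤
      ((√2 * √(variance (fun z => Real.log (p z)) (noise p)) : ℝ) : EReal) :=
  le_sqrt_two_mul_sqrt_of_forall (variance_nonneg _ _) fun _ hs =>
    scalingConstant_le_of_forall_scalingAt_le fun _ hε hε1 =>
      scalingAt_le hp hlog hτ hexp hΔ hε hε1 hs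

lemma variance_log_uniform (hp : IsPDF p) {S : Set ℝ} (hS : MeasurableSet S)
    (h : p =ᵐ[volume] S.indicator fun _ => (volume.real S)⁻¹) :
    variance (fun z => Real.log (p z)) (noise p) = 0 := by
  have := hp.isProbabilityMeasure
  have hind : Measurable (S.indicator fun _ : ℝ => (volume.real S)⁻¹) :=
    measurable_const.indicator hS
  have hnoise : noise p = noise (S.indicator fun _ => (volume.real S)⁻¹) :=
    withDensity_congr_ae (h.fun_comp ENNReal.ofReal)
  have hmem : ∀ᵐ z ∂noise p, z ∈ S := by
    rw [hnoise, noise, ae_withDensity_iff (by fun_prop)]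
    refine ae_of_all _ fun z hz => ?_
    by_contra hzS
    simp [hzS] at hz
  have hconst : (fun z => Real.log (p z)) =ᵐ[noise p] fun _ => Real.log (volume.real S)⁻¹ := by
    filter_upwards [hmem, (noise_absolutelyContinuous p).ae_le h] with z hz hpz
    rw [hpz, Set.indicator_of_mem hz]
  rw [variance_congr hconst, variance_eq_integral aemeasurable_const]
  simp

end Scaling

end CovertComm

theorem theorem1_general (p : ℝ → ℝ) (hp : CovertComm.IsPDF p) (ζ : ℝ) (hζ0 : 0 < ζ)
    (hζ1 : ζ < 1) (h0 : Integrable (fun z => p z * Real.log (p z) ^ 2) volume)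
    (h1 : Integrable (fun z => p z ^ ζ) volume) (Δ : ℝ) (hΔ : 0 < Δ) :
    Tendsto (fun ε => CovertComm.scalingAt p Δ ε) (𝓝[>] (0 : ℝ))
        (𝓝 (CovertComm.scalingConstant p Δ)) ∧
      CovertComm.scalingConstant p Δ ≤
        ((Real.sqrt 2 * Real.sqrt (variance (fun z => Real.log (p z)) (CovertComm.noise p)) : ℝ)
          : EReal) ∧
      ∀ S : Set ℝ, MeasurableSet S →
        p =ᵐ[volume] S.indicator (fun _ => (volume.real S)⁻¹) →
        CovertComm.scalingConstant p Δ = 0 := by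
  have hle := CovertComm.scalingConstant_le hp (hp.memLp_log h0) (sub_pos.2 hζ1)
    (hp.integrable_exp_excess hζ0.ne' h1) hΔ
  refine ⟨CovertComm.tendsto_scalingAt p Δ, hle, fun S hS hpS => ?_⟩
  rw [CovertComm.variance_log_uniform hp hS hpS] at hle
  exact le_antisymm (by simpa using hle) (CovertComm.scalingConstant_nonneg hp Δ)

/-- The first conjunct says that the limit over `ε ↓ 0` defining `L` exists in `[-∞, ∞]`. -/
theorem theorem1 (p : ℝ → ℝ) (hp : CovertComm.IsPDF p) (ζ : ℝ) (hζ0 : 0 < ζ) (hζ1 : ζ < 1)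
    (h0 : Integrable (fun z => p z * Real.log (p z) ^ 4) volume)
    (h1 : Integrable (fun z => p z ^ ζ) volume)
    (h2 : Integrable (fun z => p z ^ ζ * Real.log (p z) ^ 4) volume)
    (Δ : ℝ) (hΔ : 0 < Δ) :
    Tendsto (fun ε => CovertComm.scalingAt p Δ ε) (𝓝[>] (0 : ℝ))
        (𝓝 (CovertComm.scalingConstant p Δ)) ∧
      CovertComm.scalingConstant p Δ ≤
        ((Real.sqrt 2 * Real.sqrt (variance (fun z => Real.log (p z)) (CovertComm.noise p)) : ℝ)
          : EReal) ∧
      ∀ S : Set ℝ, MeasurableSet S →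
        p =ᵐ[volume] S.indicator (fun _ => (volume.real S)⁻¹) →
        CovertComm.scalingConstant p Δ = 0 :=
  theorem1_general p hp ζ hζ0 hζ1 (hp.integrable_mul_log_sq h0) h1 Δ hΔ
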